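/- Let $X$ be a complex Banach space, let $L(X)$ be the algebra of bounded linear operators on $X$, and let $T\in L(X)$. Let $\sigma_*$ denote any one of the spectrum $\sigma$, the Browder spectrum $\sigma_b$ or the Drazin spectrum $\sigma_d$, where $\sigma_b(T)$ (respectively $\sigma_d(T)$) is the set of $z\in\mathbb C$ such that $T-zI$ is not a Fredholm operator with finite ascent and finite descent (respectively not an operator with finite ascent and finite descent). For $A\subset\mathbb C$ let $\mathrm{acc}\,A$ be the set of its accumulation points and $\mathrm{iso}\,A=A\setminus\mathrm{acc}\,A$. For closed $A$ and an ordinal $\alpha$, let $\mathrm{acc}^{\alpha}A$ be the $\alpha$-th Cantor-Bendixson derivative: $\mathrm{acc}^0A=A$, $\mathrm{acc}^{\alpha+1}A=\mathrm{acc}(\mathrm{acc}^{\alpha}A)$, and $\mathrm{acc}^{\alpha}A=\bigcap_{\beta<\alpha}\mathrm{acc}^{\beta}A$ for a limit ordinal $\alpha$. Let $\omega_1$ be the first uncountable ordinal. Write $\mathrm{comm}(T)=\{S\in L(X):ST=TS\}$ and $\mathrm{comm}^2(T)=\{S\in L(X): SR=RS \text{ for all } R\in\mathrm{comm}(T)\}$.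 For a $T$-invariant subspace $M$, let $T_M$ be the restriction of $T$ to $M$. Write $(M,N)\in\mathrm{Red}(T)$ if $M,N$ are closed $T$-invariant subspaces with $X=M\oplus N$, and $(M,N)\in\mathrm{Red}^2(T)$ if $(M,N)\in\mathrm{Red}(S)$ for every $S\in\mathrm{comm}(T)$. Let $\mathcal D_{al}(T)$ be the set of all $(M,N)\in\mathrm{Red}(T)$ such that $T_M$ is invertible and $\sigma(T_N)$ is at most countable; $T$ is almost invertible if $\mathcal D_{al}(T)\neq\emptyset$. For a successor ordinal $\alpha=\beta+1$, $T$ is $g^{\alpha}_{\sigma_*}$-invertible if there is $(M,N)\in\mathrm{Red}(T)$ with $T_M$ invertible and $\mathrm{acc}^{\beta}\sigma_*(T_N)\subset\{0\}$; for a limit ordinal $\alpha$, $T$ is $g^{\alpha}_{\sigma_*}$-invertible if it is $g^{\beta}_{\sigma_*}$-invertible for some successor ordinal $\beta<\alpha$. A spectral set of $T$ is a subset of $\sigma(T)$ that is clopen in $\sigma(T)$. Then the following statements are equivalent: (i) $T$ is almost invertible; (ii) $T$ is $g^{\omega_1}_{\sigma_*}$-invertible; (iii) $0\notin\mathrm{acc}^{\omega_1}\sigma_*(T)$;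 (iv) there exists $(M,N)\in\mathrm{Red}^2(T)\cap\mathcal D_{al}(T)$; (v) there exist $T$-invariant subspaces $M,N$ such that $N$ is closed, $X=M\oplus N$ (algebraically), $T_M:M\to M$ is bijective and $\sigma_*(T_N)$ is at most countable; (vi) there exists an at most countable spectral set $\tilde\sigma$ of $T$ such that $0\notin\sigma(T)\setminus\tilde\sigma$; (vii) there exists a spectral set $\tilde\sigma$ of $T$ such that $0\notin\sigma(T)\setminus\tilde\sigma$ and $\tilde\sigma\setminus\{0\}\subset\bigcup_{\beta<\omega_1}\mathrm{iso}(\mathrm{acc}^{\beta}\sigma(T))$; (viii) there exists a bounded projection $P\in\mathrm{comm}(T)$ such that $T+P$ is almost invertible and $\sigma_*(TP)$ is at most countable; (ix) there exists a bounded projection $P\in\mathrm{comm}^2(T)$ such that $T+P$ is almost invertible and $\sigma_*(TP)$ is at most countable; (x) there exists $S\in\mathrm{comm}(T)$ such that $S^2T=S$ and $\sigma_*(T-T^2S)$ is at most countable; (xi) there exists $S\in\mathrm{comm}^2(T)$ such that $S^2T=S$ and $\sigma_*(T-T^2S)$ is at most countable. -/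

import Mathlib

open scoped Ordinal

namespace AlmostInv

section Spectra

variable {X : Type*} [NormedAddCommGroup X] [NormedSpace ℂ X]

/-- Finite ascent: the chain of kernels `ker T ⊆ ker T² ⊆ …` becomes stationary. -/
def FiniteAscent (T : X →L[ℂ] X) : Prop :=
  ∃ p : ℕ, (T ^ p).ker = (T ^ (p + 1)).ker

/-- Finite descent: the chain of ranges `ran T ⊇ ran T² ⊇ …` becomes stationary. -/
def FiniteDescent (T : X →L[ℂ] X) : Prop :=
  ∃ q : ℕ, (T ^ q).range = (T ^ (q + 1)).range

/-- `T` is Drazin invertible if it has finite ascent and finite descent. -/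
def IsDrazinInvertible (T : X →L[ℂ] X) : Prop :=
  FiniteAscent T ∧ FiniteDescent T

/-- `T` is a Browder operator if it is Fredholm with finite ascent and finite descent. -/
def IsBrowder (T : X →L[ℂ] X) : Prop :=
  T.IsFredholm ∧ FiniteAscent T ∧ FiniteDescent T

/-- The Drazin spectrum `σ_d(T)`. -/
def drazinSpectrum (T : X →L[ℂ] X) : Set ℂ :=
  {z | ¬ IsDrazinInvertible (T - z • (1 : X →L[ℂ] X))}

/-- The Browder spectrum `σ_b(T)`. -/
def browderSpectrum (T : X →L[ℂ] X) : Set ℂ :=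
  {z | ¬ IsBrowder (T - z • (1 : X →L[ℂ] X))}

end Spectra

/-- The three possible choices for `σ_*`. -/
inductive SpectrumKind
  | usual
  | browder
  | drazin

section Operators

variable {X : Type*} [NormedAddCommGroup X] [NormedSpace ℂ X]

/-- `σ_*(T)`, where `σ_*` is one of `σ`, `σ_b`, `σ_d`. -/
def sigmaStar (k : SpectrumKind) (T : X →L[ℂ] X) : Set ℂ :=
  match k with
  | .usual => spectrum ℂ T
  | .browder => browderSpectrum T
  | .drazin => drazinSpectrum T

/-- The `α`-th Cantor-Bendixson derivative of `A`. At a successor step this takes the accumulation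
points of the previous stage that belong to that stage; for a closed set `A` (such as each of the
spectra considered here) all stages are closed, so these are all its accumulation points. -/
noncomputable def acc (α : Ordinal.{0}) (A : Set ℂ) : Set ℂ :=
  CantorBendixson.iteratedDerivedSet A α

/-- The isolated points of `A`. -/
def iso (A : Set ℂ) : Set ℂ := A \ derivedSet A

/-- The commutant of `T`. -/
def comm (T : X →L[ℂ] X) : Set (X →L[ℂ] X) := Set.centralizer {T}

/-- The double commutant of `T`. -/
def comm2 (T : X →L[ℂ] X) : Set (X →L[ℂ] X) := Set.centralizer (comm T)

/-- `(M, N) ∈ Red(T)`: `M` and `N` are closed `T`-invariant subspaces and `X = M ⊕ N`. -/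
structure IsRed (T : X →L[ℂ] X) (M N : Submodule ℂ X) : Prop where
  inv_left : ∀ x ∈ M, T x ∈ M
  inv_right : ∀ x ∈ N, T x ∈ N
  closed_left : IsClosed (M : Set X)
  closed_right : IsClosed (N : Set X)
  isCompl : IsCompl M N

/-- `(M, N) ∈ Red²(T)`: the pair reduces every operator that commutes with `T`. -/
def IsRed2 (T : X →L[ℂ] X) (M N : Submodule ℂ X) : Prop :=
  ∀ S ∈ comm T, IsRed S M N

/-- `(M, N) ∈ D_al(T)`: `(M, N) ∈ Red(T)`, `T_M` is invertible and `σ(T_N)` is at most countable. -/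
def IsAlmostInvPair (T : X →L[ℂ] X) (M N : Submodule ℂ X) : Prop :=
  ∃ h : IsRed T M N, IsUnit (T.restrict h.inv_left) ∧
    (spectrum ℂ (T.restrict h.inv_right)).Countable

/-- `T` is almost invertible. -/
def IsAlmostInvertible (T : X →L[ℂ] X) : Prop :=
  ∃ M N : Submodule ℂ X, IsAlmostInvPair T M N

/-- Successor case of `g_{σ_*}^α`-invertibility, `α = β + 1`: there is `(M, N) ∈ Red(T)` with `T_M`
invertible and `acc^β σ_*(T_N) ⊆ {0}`. -/
def IsGInvertibleSucc (k : SpectrumKind) (β : Ordinal.{0}) (T : X →L[ℂ] X) : Prop :=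
  ∃ (M N : Submodule ℂ X) (h : IsRed T M N), IsUnit (T.restrict h.inv_left) ∧
    acc β (sigmaStar k (T.restrict h.inv_right)) ⊆ {0}

/-- `T` is `g_{σ_*}^α`-invertible: the cases `α = 0`, `α` a successor, `α` a limit ordinal. -/
def IsGInvertible (k : SpectrumKind) (α : Ordinal.{0}) (T : X →L[ℂ] X) : Prop :=
  (α = 0 ∧ (0 : ℂ) ∉ sigmaStar k T) ∨
  (∃ β : Ordinal.{0}, α = β + 1 ∧ IsGInvertibleSucc k β T) ∨
  (Order.IsSuccLimit α ∧ ∃ β : Ordinal.{0}, β + 1 < α ∧ IsGInvertibleSucc k β T)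

/-- `s` is a spectral set of `T`: a subset of `σ(T)` that is clopen in `σ(T)`. -/
def IsSpectralSet (T : X →L[ℂ] X) (s : Set ℂ) : Prop :=
  s ⊆ spectrum ℂ T ∧ IsClopen ((↑) ⁻¹' s : Set (spectrum ℂ T))

end Operators

end AlmostInv

/-! All the conditions say that `σ(T)` is countable near `0`, i.e. meets some neighbourhood of `0`
in a countable set. For a closed set `A` in a Polish space, `acc^{ω₁} A` is perfect with countable
complement in `A`, so it is the set of condensation points of `A`; since `acc σ(T) ⊆ σ_*(T) ⊆ σ(T)`
and `σ(T) \ acc σ(T)` is countable, these are the same for `σ_*` as for `σ`.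

If `σ(T)` is countable near `0`, some annulus around `0` misses `σ(T)`, and the Laurent coefficients
of the resolvent there provide, in the double commutant of `T`, the Riesz idempotent of the part of
`σ(T)` inside the annulus and an inverse of `T` on the complementary summand. Conversely, if
`X = M ⊕ N` with `T_M` bijective, then `σ(T) = σ(T_M) ∪ σ(T_N)`, and `σ(T_M)` stays away from `0`
because `T_M` is similar to the operator induced by `T` on the Banach space `X ⧸ N`. -/

namespace AlmostInv

open Filter Topology Set Metric CantorBendixson

section CantorBendixson

universe u

variable {Y : Type u}

/-- `s` is countable near `x`, that is, `x` is not a condensation point of `s`. -/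
def CountableNear [TopologicalSpace Y] (s : Set Y) (x : Y) : Prop :=
  ∃ U ∈ 𝓝 x, (U ∩ s).Countable

namespace CountableNear

variable [TopologicalSpace Y] {s t : Set Y} {x : Y}

theorem of_countable (hs : s.Countable) (x : Y) : CountableNear s x :=
  ⟨univ, univ_mem, hs.mono inter_subset_right⟩

theorem mono_eventually (ht : CountableNear t x) (h : ∀ᶠ y in 𝓝 x, y ∈ s → y ∈ t) :
    CountableNear s x := by
  obtain ⟨U, hU, hUt⟩ := ht
  refine ⟨{y | y ∈ s → y ∈ t} ∩ U, inter_mem h hU, hUt.mono ?_⟩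
  rintro y ⟨⟨hst, hyU⟩, hys⟩
  exact ⟨hyU, hst hys⟩

theorem mono (ht : CountableNear t x) (h : s ⊆ t) : CountableNear s x :=
  ht.mono_eventually (Eventually.of_forall fun _ hy => h hy)

theorem union_countable (hs : CountableNear s x) (ht : t.Countable) : CountableNear (s ∪ t) x := by
  obtain ⟨U, hU, hUs⟩ := hs
  refine ⟨U, hU, ?_⟩
  rw [inter_union_distrib_left]
  exact hUs.union (ht.mono inter_subset_right)

end CountableNear

theorem isSuccLimit_omega_one : Order.IsSuccLimit (ω₁ : Ordinal.{u}) :=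
  Cardinal.isSuccLimit_omega 1

theorem not_countable_of_perfect [MetricSpace Y] [CompleteSpace Y] {s : Set Y} (hs : Perfect s)
    (hne : s.Nonempty) : ¬ s.Countable := by
  intro hc
  obtain ⟨f, hfs, -, hf⟩ := hs.exists_nat_bool_injection hne
  have huncountable : Uncountable (ℕ → Bool) := by
    rw [← Cardinal.aleph0_lt_mk_iff]
    simp [Cardinal.aleph0_lt_continuum]
  exact huncountable.not_countable <| countable_univ_iff.1 <|
    countable_of_injective_of_countable_image hf.injOn (hc.mono (image_univ ▸ hfs))

section TopologicalSpace

variable [TopologicalSpace Y] {s t : Set Y}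

theorem iteratedDerivedSet_subset (s : Set Y) (a : Ordinal.{u}) : sᵈ[a] ⊆ s := by
  simpa only [iteratedDerivedSet_zero] using iteratedDerivedSet_antitone s (zero_le (a := a))

theorem sdiff_iteratedDerivedSet_eq_iUnion (s : Set Y) (a : Ordinal.{u}) :
    s \ sᵈ[a] = ⋃ b < a, sᵈ[b] \ derivedSet sᵈ[b] := by
  apply Subset.antisymm
  · rintro x ⟨hx, hxa⟩
    by_contra hcon
    simp only [mem_iUnion, Set.mem_sdiff, not_exists, not_and, not_not] at hcon
    have hstage : ∀ b ≤ a, x ∈ sᵈ[b] := by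
      intro b
      induction b using Ordinal.limitRecOn with
      | zero => exact fun _ => by rwa [iteratedDerivedSet_zero]
      | add_one b ih =>
        intro hb
        have hba := (lt_add_one b).trans_le hb
        rw [iteratedDerivedSet_succ]
        exact ⟨hcon b hba (ih hba.le), ih hba.le⟩
      | limit b hb ih =>
        intro hba
        rw [iteratedDerivedSet_limit hb]
        exact mem_iInter.2 fun c => ih c c.2 (c.2.le.trans hba)
    exact hxa (hstage a le_rfl)
  · refine iUnion₂_subset fun b hb x hx => ⟨iteratedDerivedSet_subset s b hx.1, fun hxa => hx.2 ?_⟩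
    have hsucc := iteratedDerivedSet_antitone s (Order.add_one_le_of_lt hb) hxa
    rw [iteratedDerivedSet_succ] at hsucc
    exact hsucc.1

theorem iteratedDerivedSet_add_one_eq_empty {a : Ordinal.{u}} (h : sᵈ[a].Subsingleton) :
    sᵈ[a + 1] = ∅ := by
  rw [iteratedDerivedSet_succ, eq_empty_iff_forall_notMem]
  rintro x ⟨hx, hxs⟩
  obtain ⟨y, hy, hne⟩ := accPt_iff_nhds.1 (mem_derivedSet.1 hx) univ univ_mem
  exact hne (h hy.2 hxs)

theorem isClosed_of_derivedSet_subset (hst : derivedSet s ⊆ t) (hts : t ⊆ s) : IsClosed t :=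
  (isClosed_iff_derivedSet_subset t).2 ((derivedSet_mono _ _ hts).trans hst)

section SecondCountable

variable [SecondCountableTopology Y]

theorem countable_sdiff_iteratedDerivedSet (hs : IsClosed s) (a : Ordinal.{u}) :
    (s \ sᵈ[a]).Countable := by
  obtain ⟨V, D, hV, hD, rfl⟩ := exists_countable_union_perfect_of_isClosed hs
  refine hV.mono fun x hx => hx.1.resolve_right fun hxD => hx.2 ?_
  exact perfectKernel_subset_iteratedDerivedSet _ a
    (hD.subset_perfectKernel subset_union_right hxD)

theorem countableNear_of_notMem_iteratedDerivedSet (hs : IsClosed s) {a : Ordinal.{u}} {x : Y}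
    (hx : x ∉ sᵈ[a]) : CountableNear s x :=
  ⟨sᵈ[a]ᶜ, (isClosed_iteratedDerivedSet hs a).isOpen_compl.mem_nhds hx, by
    simpa only [inter_comm, ← sdiff_eq] using countable_sdiff_iteratedDerivedSet hs a⟩

theorem exists_lt_omega_one_iteratedDerivedSet_eq (hs : IsClosed s) :
    ∃ b < (ω₁ : Ordinal.{u}), sᵈ[b] = sᵈ[(ω₁ : Ordinal.{u})] := by
  have hleave : ∀ x : ↥(s \ sᵈ[(ω₁ : Ordinal.{u})]), ∃ b < (ω₁ : Ordinal.{u}), (x : Y) ∉ sᵈ[b] := by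
    rintro ⟨x, -, hx⟩
    rw [iteratedDerivedSet_limit isSuccLimit_omega_one] at hx
    simpa only [mem_iInter, Subtype.forall, mem_Iio, not_forall, exists_prop] using hx
  choose stage hstage hnotMem using hleave
  have : Countable ↥(s \ sᵈ[(ω₁ : Ordinal.{u})]) :=
    (countable_sdiff_iteratedDerivedSet hs _).to_subtype
  have hsup : ⨆ x, stage x < ω₁ := Ordinal.iSup_lt_omega_one hstage
  refine ⟨⨆ x, stage x, hsup, Subset.antisymm (fun x hx => ?_)
    (iteratedDerivedSet_antitone s hsup.le)⟩
  by_contra hx'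
  exact hnotMem ⟨x, iteratedDerivedSet_subset s _ hx, hx'⟩
    (iteratedDerivedSet_antitone s (Ordinal.le_iSup stage _) hx)

theorem perfect_iteratedDerivedSet_omega_one (hs : IsClosed s) :
    Perfect sᵈ[(ω₁ : Ordinal.{u})] := by
  obtain ⟨b, hb, hbω⟩ := exists_lt_omega_one_iteratedDerivedSet_eq hs
  have hsucc : sᵈ[b + 1] = sᵈ[b] :=
    Subset.antisymm (iteratedDerivedSet_antitone s (le_add_of_nonneg_right zero_le_one))
      (hbω ▸ iteratedDerivedSet_antitone s (Order.add_one_le_of_lt hb))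
  rw [← hbω, ← perfectKernel_eq_iteratedDerivedSet_of_mem_fixedPoints
    (mem_fixedPoints_of_iteratedDerivedSet_succ_eq hsucc)]
  exact perfect_perfectKernel hs

theorem countable_sdiff_of_derivedSet_subset (hs : IsClosed s) (hst : derivedSet s ⊆ t) :
    (s \ t).Countable := by
  refine (countable_sdiff_iteratedDerivedSet hs 1).mono (sdiff_subset_sdiff_right ?_)
  rw [← zero_add 1, iteratedDerivedSet_succ, iteratedDerivedSet_zero]
  exact inter_subset_left.trans hst

end SecondCountable

end TopologicalSpace

section Polish

variable [MetricSpace Y] [CompleteSpace Y] [SecondCountableTopology Y] {s : Set Y}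

theorem notMem_iteratedDerivedSet_omega_one_iff (hs : IsClosed s) {x : Y} :
    x ∉ sᵈ[(ω₁ : Ordinal.{u})] ↔ CountableNear s x := by
  refine ⟨countableNear_of_notMem_iteratedDerivedSet hs, fun ⟨U, hU, hUs⟩ hx => ?_⟩
  obtain ⟨r, hr, hrU⟩ := nhds_basis_closedBall.mem_iff.1 hU
  obtain ⟨hperf, hne⟩ := (perfect_iteratedDerivedSet_omega_one hs).closure_nhds_inter x hx
    (mem_ball_self hr) isOpen_ball
  refine not_countable_of_perfect hperf hne (hUs.mono ?_)
  refine closure_minimal ?_ (isClosed_closedBall.inter hs) |>.trans (inter_subset_inter_left _ hrU)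
  exact inter_subset_inter ball_subset_closedBall (iteratedDerivedSet_subset s _)

theorem exists_iteratedDerivedSet_eq_empty_iff (hs : IsClosed s) :
    (∃ b < (ω₁ : Ordinal.{u}), sᵈ[b] = ∅) ↔ s.Countable := by
  refine ⟨fun ⟨b, _, hb⟩ => ?_, fun hc => ?_⟩
  · simpa only [hb, sdiff_empty] using countable_sdiff_iteratedDerivedSet hs b
  · obtain ⟨b, hb, hbω⟩ := exists_lt_omega_one_iteratedDerivedSet_eq hs
    refine ⟨b, hb, hbω.trans (eq_empty_of_forall_notMem fun x => ?_)⟩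
    exact (notMem_iteratedDerivedSet_omega_one_iff hs).2 (.of_countable hc x)

theorem exists_iteratedDerivedSet_subset_singleton_iff (hs : IsClosed s) (x : Y) :
    (∃ b : Ordinal.{u}, b + 1 < ω₁ ∧ sᵈ[b] ⊆ {x}) ↔ s.Countable := by
  rw [← exists_iteratedDerivedSet_eq_empty_iff hs]
  constructor
  · rintro ⟨b, hb, hbx⟩
    exact ⟨b + 1, hb, iteratedDerivedSet_add_one_eq_empty (subsingleton_singleton.anti hbx)⟩
  · rintro ⟨b, hb, hempty⟩
    exact ⟨b, isSuccLimit_omega_one.add_one_lt hb, hempty ▸ empty_subset _⟩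

end Polish

theorem CountableNear.exists_annulus [MetricSpace Y] [ProperSpace Y] {s : Set Y} {x : Y}
    (h : CountableNear s x) (hs : IsClosed s) :
    ∃ r R, 0 < r ∧ r < R ∧ (closedBall x R ∩ s).Countable ∧
      Disjoint (closedBall x R \ ball x r) s := by
  obtain ⟨U, hU, hUs⟩ := h
  obtain ⟨ε, hε, hεU⟩ := nhds_basis_closedBall.mem_iff.1 hU
  have hc : (closedBall x ε ∩ s).Countable := hUs.mono (inter_subset_inter_left s hεU)
  set radii : Set ℝ := (dist · x) '' (closedBall x ε ∩ s)
  obtain ⟨r, hr, hr0, hrε⟩ := ((hc.image (dist · x)).dense_compl ℝ).exists_between hε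
  have hclosed : IsClosed radii :=
    (((isCompact_closedBall x ε).inter_right hs).image (by fun_prop)).isClosed
  obtain ⟨δ, hδ, hδr⟩ := nhds_basis_closedBall.mem_iff.1 (hclosed.isOpen_compl.mem_nhds hr)
  have hRε : min (r + δ) ε ≤ ε := min_le_right _ _
  refine ⟨r, min (r + δ) ε, hr0, lt_min (lt_add_of_pos_right r hδ) hrε,
    hc.mono (inter_subset_inter_left s (closedBall_subset_closedBall hRε)), ?_⟩
  refine disjoint_left.2 fun y ⟨hyR, hyr⟩ hys => ?_
  rw [mem_closedBall] at hyR
  rw [mem_ball, not_lt] at hyr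
  have hyr' : dist y x ∈ closedBall r δ := by
    rw [mem_closedBall, Real.dist_eq, abs_of_nonneg (sub_nonneg.2 hyr)]
    linarith [hyR.trans (min_le_left _ _)]
  exact hδr hyr' ⟨y, ⟨mem_closedBall.2 (hyR.trans hRε), hys⟩, rfl⟩

end CantorBendixson

section Ring

variable {R : Type*} [Ring R]

theorem isUnit_of_mul_idempotent_eq {p b c x : R} (hp : IsIdempotentElem p) (hpb : Commute p b)
    (hpc : Commute p c) (hb : IsUnit b) (hc : IsUnit c) (hxb : x * p = b * p)
    (hxc : x * (1 - p) = c * (1 - p)) : IsUnit x := by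
  obtain ⟨u, rfl⟩ := hb
  obtain ⟨v, rfl⟩ := hc
  have hpq : p * (1 - p) = 0 := by rw [mul_sub, mul_one, hp.eq, sub_self]
  have hx : x = u * p + v * (1 - p) := by rw [← hxb, ← hxc, ← mul_add, add_sub_cancel, mul_one]
  have hqv : Commute (1 - p) ↑v := (Commute.one_left _).sub_left hpc
  have hpx : p * x = u * p := by
    rw [hx, mul_add, hpb.left_comm, hpc.left_comm, hp.eq, hpq, mul_zero, add_zero]
  have hqx : (1 - p) * x = v * (1 - p) := by rw [sub_mul, one_mul, hpx, hx, add_sub_cancel_left]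
  refine ⟨⟨x, ↑u⁻¹ * p + ↑v⁻¹ * (1 - p), ?_, ?_⟩, rfl⟩
  · rw [← hpb.units_inv_right.eq, ← hqv.units_inv_right.eq, mul_add, ← mul_assoc, ← mul_assoc, hxb,
      hxc, hpb.symm.eq, hqv.symm.eq, mul_assoc, mul_assoc, Units.mul_inv, Units.mul_inv, mul_one,
      mul_one, add_sub_cancel]
  · rw [add_mul, mul_assoc, mul_assoc, hpx, hqx, Units.inv_mul_cancel_left,
      Units.inv_mul_cancel_left, add_sub_cancel]

theorem commute_one_sub_mul {a b s : R} (hs : Commute b s) (ha : Commute b a) :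
    Commute b (1 - s * a) :=
  (Commute.one_right b).sub_right (hs.mul_right ha)

/-- `s` is an outer inverse of `a` (that is, `s * a * s = s`) commuting with `a`; given the
commutation, the equation takes the form `s ^ 2 * a = s`. -/
structure IsCommutingOuterInverse (a s : R) : Prop where
  commute : Commute s a
  sq_mul : s ^ 2 * a = s

namespace IsCommutingOuterInverse

variable {a s : R}

theorem mul_mul_self (h : IsCommutingOuterInverse a s) : s * a * s = s := by
  rw [mul_assoc, ← h.commute.eq, ← mul_assoc, ← sq, h.sq_mul]

theorem isIdempotentElem (h : IsCommutingOuterInverse a s) : IsIdempotentElem (s * a) := by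
  rw [IsIdempotentElem, ← mul_assoc, h.mul_mul_self]

theorem commute_mul (h : IsCommutingOuterInverse a s) : Commute (s * a) a :=
  h.commute.mul_left (Commute.refl a)

theorem isUnit_mul_add_one_sub (h : IsCommutingOuterInverse a s) :
    IsUnit (a * (s * a) + (1 - s * a)) := by
  have hqs : s * a * s = s := h.mul_mul_self
  have hq : s * a * (s * a) = s * a := h.isIdempotentElem
  have hcomm : Commute (a * (s * a) + (1 - s * a)) (s + (1 - s * a)) := by
    have has := h.commute.symm
    have hqa := h.commute_mul
    have hqs_comm : Commute (s * a) s := (Commute.refl s).mul_left has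
    exact ((has.mul_left hqs_comm).add_left ((Commute.one_left s).sub_left hqs_comm)).add_right
      ((Commute.one_right _).sub_right ((hqa.symm.mul_left (Commute.refl _)).add_left
        ((Commute.one_left _).sub_left (Commute.refl _))))
  have hmul : (a * (s * a) + (1 - s * a)) * (s + (1 - s * a)) = 1 := by
    calc (a * (s * a) + (1 - s * a)) * (s + (1 - s * a))
        = a * (s * a * s) + a * (s * a - s * a * (s * a)) + (s - s * a * s)
          + (1 - s * a - s * a + s * a * (s * a)) := by noncomm_ring
      _ = a * s + (1 - s * a) := by rw [hqs, hq]; noncomm_ring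
      _ = 1 := by rw [h.commute.eq]; exact add_sub_cancel _ _
  exact (hcomm.isUnit_mul_iff.1 (hmul.symm ▸ isUnit_one)).1

end IsCommutingOuterInverse

end Ring

section Algebra

variable {𝕜 A : Type*}

theorem mem_centralizer_centralizer_singleton [Mul A] {a s : A} :
    s ∈ centralizer (centralizer {a}) ↔ ∀ b, Commute b a → Commute b s := by
  simp only [mem_centralizer_iff, mem_singleton_iff, forall_eq, commute_iff_eq,
    eq_comm (a := a * _)]

section Spectrum

variable [Field 𝕜] [Ring A] [Algebra 𝕜 A] {a b c p : A}

theorem spectrum_subset_union_of_mul_idempotent_eq (hp : IsIdempotentElem p) (hpb : Commute p b)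
    (hpc : Commute p c) (hab : a * p = b * p) (hac : a * (1 - p) = c * (1 - p)) :
    spectrum 𝕜 a ⊆ spectrum 𝕜 b ∪ spectrum 𝕜 c := by
  intro z hz
  by_contra hcon
  rw [mem_union, not_or, spectrum.notMem_iff, spectrum.notMem_iff] at hcon
  have hpz : Commute p (algebraMap 𝕜 A z) := Algebra.commute_algebraMap_right z p
  exact hz (isUnit_of_mul_idempotent_eq hp (hpz.sub_right hpb) (hpz.sub_right hpc) hcon.1 hcon.2
    (by rw [sub_mul, sub_mul, hab]) (by rw [sub_mul, sub_mul, hac]))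

theorem spectrum_mul_idempotent_subset (hp : IsIdempotentElem p) (hpa : Commute p a) :
    spectrum 𝕜 (a * p) ⊆ insert 0 (spectrum 𝕜 a) := by
  have hzero : spectrum 𝕜 (0 : A) ⊆ {0} := by
    nontriviality A
    exact spectrum.zero_eq.subset
  refine (spectrum_subset_union_of_mul_idempotent_eq hp hpa (Commute.zero_right p)
    (by rw [mul_assoc, hp.eq]) ?_).trans ?_
  · rw [mul_assoc, mul_sub, mul_one, hp.eq, sub_self, mul_zero, zero_mul]
  · exact union_subset (subset_insert _ _) (hzero.trans (by simp))

theorem spectrum_subset_spectrum_add_idempotent_union (hp : IsIdempotentElem p)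
    (hpa : Commute p a) : spectrum 𝕜 a ⊆ spectrum 𝕜 (a + p) ∪ spectrum 𝕜 (a * p) := by
  rw [union_comm]
  refine spectrum_subset_union_of_mul_idempotent_eq hp (hpa.mul_right (Commute.refl p))
    (hpa.add_right (Commute.refl p)) (by rw [mul_assoc, hp.eq]) ?_
  rw [add_mul, mul_sub p, mul_one, hp.eq, sub_self, add_zero]

theorem countableNear_spectrum_of_add_idempotent [TopologicalSpace 𝕜] {z : 𝕜}
    (hp : IsIdempotentElem p) (hpa : Commute p a) (h : CountableNear (spectrum 𝕜 (a + p)) z)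
    (hc : (spectrum 𝕜 (a * p)).Countable) : CountableNear (spectrum 𝕜 a) z :=
  (h.union_countable hc).mono (spectrum_subset_spectrum_add_idempotent_union hp hpa)

end Spectrum

section CompleteNormedAlgebra

variable [NontriviallyNormedField 𝕜] [NormedRing A] [NormedAlgebra 𝕜 A] [CompleteSpace A]

theorem eventually_notMem_spectrum_of_isUnit {u : A} (hu : IsUnit u) :
    ∀ᶠ z in 𝓝 (0 : 𝕜), z ∉ spectrum 𝕜 u :=
  (spectrum.isClosed u).isOpen_compl.mem_nhds (spectrum.zero_notMem_iff 𝕜 |>.2 hu)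

namespace IsCommutingOuterInverse

variable {a s : A}

theorem eventually_mem_spectrum (h : IsCommutingOuterInverse a s) :
    ∀ᶠ z in 𝓝 (0 : 𝕜), z ∈ spectrum 𝕜 a → z ∈ spectrum 𝕜 (a * (1 - s * a)) := by
  have hq := h.isIdempotentElem
  have hqa := h.commute_mul
  have hq1 : Commute (s * a) (1 - s * a) := (Commute.one_right _).sub_right (Commute.refl _)
  filter_upwards [eventually_notMem_spectrum_of_isUnit h.isUnit_mul_add_one_sub] with z hz hza
  refine (spectrum_subset_union_of_mul_idempotent_eq hq
    ((hqa.mul_right (Commute.refl _)).add_right hq1) (hqa.mul_right hq1) ?_ ?_ hza).resolve_left hz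
  · rw [add_mul, mul_assoc a, sub_mul, one_mul, hq.eq, sub_self, add_zero]
  · rw [mul_assoc a, hq.one_sub.eq]

theorem eventually_mem_spectrum_add_one_sub (h : IsCommutingOuterInverse a s) :
    ∀ᶠ z in 𝓝 (0 : 𝕜), z ∈ spectrum 𝕜 (a + (1 - s * a)) →
      z ∈ spectrum 𝕜 (a * (1 - s * a) + 1) := by
  have hq := h.isIdempotentElem
  have hqa := h.commute_mul
  have hq1 : Commute (s * a) (1 - s * a) := (Commute.one_right _).sub_right (Commute.refl _)
  filter_upwards [eventually_notMem_spectrum_of_isUnit h.isUnit_mul_add_one_sub] with z hz hza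
  refine (spectrum_subset_union_of_mul_idempotent_eq hq
    ((hqa.mul_right (Commute.refl _)).add_right hq1)
    ((hqa.mul_right hq1).add_right (Commute.one_right _)) ?_ ?_ hza).resolve_left hz
  · rw [add_mul, add_mul, mul_assoc a, hq.eq]
  · rw [add_mul, add_mul, mul_assoc a, hq.one_sub.eq, one_mul]

theorem countableNear_spectrum (h : IsCommutingOuterInverse a s)
    (hc : (spectrum 𝕜 (a * (1 - s * a))).Countable) : CountableNear (spectrum 𝕜 a) 0 :=
  (CountableNear.of_countable hc 0).mono_eventually h.eventually_mem_spectrum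

theorem countableNear_spectrum_add_one_sub (h : IsCommutingOuterInverse a s)
    (hc : (spectrum 𝕜 (a * (1 - s * a))).Countable) :
    CountableNear (spectrum 𝕜 (a + (1 - s * a))) 0 := by
  refine (CountableNear.of_countable ?_ 0).mono_eventually h.eventually_mem_spectrum_add_one_sub
  have hshift := spectrum.add_singleton_eq (a * (1 - s * a)) (1 : 𝕜)
  rw [map_one, add_singleton] at hshift
  exact hshift ▸ hc.image _

end IsCommutingOuterInverse

end CompleteNormedAlgebra

end Algebra

section Resolvent

theorem commute_ringInverse_right {M₀ : Type*} [MonoidWithZero M₀] {a b : M₀}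
    (h : Commute a b) : Commute a (Ring.inverse b) := by
  by_cases hb : IsUnit b
  · obtain ⟨u, rfl⟩ := hb
    exact Ring.inverse_unit u ▸ h.units_inv_right
  · exact Ring.inverse_non_unit b hb ▸ Commute.zero_right a

variable {R A : Type*} [CommSemiring R] [Ring A] [Algebra R A] {a : A} {r : R}

theorem resolvent_mem_centralizer_centralizer (a : A) (r : R) :
    resolvent a r ∈ centralizer (centralizer {a}) :=
  mem_centralizer_centralizer_singleton.2 fun b hb =>
    commute_ringInverse_right ((Algebra.commute_algebraMap_right r b).sub_right hb)

theorem mul_resolvent (hr : r ∈ resolventSet R a) :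
    a * resolvent a r = r • resolvent a r - 1 := by
  have hinv : (algebraMap R A r - a) * resolvent a r = 1 := Ring.mul_inverse_cancel _ hr
  rw [← hinv, sub_mul, ← Algebra.smul_def, sub_sub_cancel]

end Resolvent

section LaurentCoeff

open Complex
open scoped Real

theorem circleIntegral_comp_comm {E F : Type*} [NormedAddCommGroup E] [NormedSpace ℂ E]
    [CompleteSpace E] [NormedAddCommGroup F] [NormedSpace ℂ F] [CompleteSpace F] (L : E →L[ℂ] F)
    {f : ℂ → E} {c : ℂ} {r : ℝ} (hf : CircleIntegrable f c r) :
    ∮ z in C(c, r), L (f z) = L (∮ z in C(c, r), f z) := by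
  simp only [circleIntegral, ← map_smul]
  exact L.intervalIntegral_comp_comm hf.out

theorem circleIntegral_zpow {r : ℝ} (hr : r ≠ 0) (n : ℤ) :
    ∮ z in C(0, r), z ^ n = if n = -1 then 2 * π * I else 0 := by
  split_ifs with hn
  · simpa only [hn, sub_zero, zpow_neg_one] using circleIntegral.integral_sub_center_inv 0 hr
  · simpa only [sub_zero] using circleIntegral.integral_sub_zpow_of_ne hn 0 0 r

variable {A : Type*} [NormedRing A] [NormedAlgebra ℂ A]

/-- The coefficient of `z ^ (-n - 1)` in the Laurent expansion about `0` of the resolvent of `a` on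
an annulus of `resolventSet ℂ a` containing the circle of radius `r`. -/
noncomputable def laurentCoeff (a : A) (r : ℝ) (n : ℤ) : A :=
  (2 * π * I : ℂ)⁻¹ • ∮ z in C(0, r), z ^ n • resolvent a z

variable [CompleteSpace A] {a b : A} {r R : ℝ}

theorem continuousOn_zpow_smul_resolvent {s : Set ℂ} (hs : s ⊆ resolventSet ℂ a)
    (h0 : (0 : ℂ) ∉ s) (n : ℤ) : ContinuousOn (fun z : ℂ => z ^ n • resolvent a z) s := fun z hz =>
  ((continuousAt_zpow₀ z n (Or.inl (ne_of_mem_of_not_mem hz h0))).smul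
    (spectrum.hasDerivAt_resolvent_const_left (hs hz)).continuousAt).continuousWithinAt

theorem circleIntegrable_zpow_smul_resolvent (hr : 0 < r)
    (h : sphere (0 : ℂ) r ⊆ resolventSet ℂ a) (n : ℤ) :
    CircleIntegrable (fun z : ℂ => z ^ n • resolvent a z) 0 r :=
  (continuousOn_zpow_smul_resolvent h (by simp [hr.ne]) n).circleIntegrable hr.le

theorem mul_laurentCoeff (hr : 0 < r) (h : sphere (0 : ℂ) r ⊆ resolventSet ℂ a) (n : ℤ) :
    a * laurentCoeff a r n = laurentCoeff a r (n + 1) - if n = -1 then 1 else 0 := by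
  have hmul : EqOn (fun z : ℂ => a * z ^ n • resolvent a z)
      (fun z => z ^ (n + 1) • resolvent a z - z ^ n • 1) (sphere 0 r) := by
    intro z hz
    have hz0 : z ≠ 0 := ne_zero_of_mem_sphere hr.ne' ⟨z, hz⟩
    simp only [mul_smul_comm, mul_resolvent (h hz), smul_sub, smul_smul, zpow_add_one₀ hz0]
  have hone : CircleIntegrable (fun z : ℂ => z ^ n • (1 : A)) 0 r := by
    refine ContinuousOn.circleIntegrable hr.le (ContinuousOn.smul ?_ continuousOn_const)
    exact fun z hz => (continuousAt_zpow₀ z n (Or.inl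
      (ne_zero_of_mem_sphere hr.ne' ⟨z, hz⟩))).continuousWithinAt
  have hcomm := circleIntegral_comp_comm (ContinuousLinearMap.mul ℂ A a)
    (circleIntegrable_zpow_smul_resolvent hr h n)
  simp only [ContinuousLinearMap.mul_apply'] at hcomm
  rw [laurentCoeff, mul_smul_comm, ← hcomm, circleIntegral.integral_congr hr.le hmul,
    circleIntegral.integral_sub (circleIntegrable_zpow_smul_resolvent hr h (n + 1)) hone,
    circleIntegral.integral_smul_const, circleIntegral_zpow hr.ne', smul_sub, ← laurentCoeff]
  split_ifs
  · rw [smul_smul, inv_mul_cancel₀ two_pi_I_ne_zero, one_smul]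
  · rw [zero_smul, smul_zero]

theorem laurentCoeff_mem_centralizer_centralizer (hr : 0 < r)
    (h : sphere (0 : ℂ) r ⊆ resolventSet ℂ a) (n : ℤ) :
    laurentCoeff a r n ∈ centralizer (centralizer {a}) := by
  refine mem_centralizer_centralizer_singleton.2 fun b hb => Commute.smul_right ?_ _
  have hint := circleIntegrable_zpow_smul_resolvent hr h n
  have hleft := circleIntegral_comp_comm (ContinuousLinearMap.mul ℂ A b) hint
  have hright := circleIntegral_comp_comm ((ContinuousLinearMap.mul ℂ A).flip b) hint
  simp only [ContinuousLinearMap.mul_apply', ContinuousLinearMap.flip_apply] at hleft hright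
  have hres (z : ℂ) : Commute b (resolvent a z) :=
    mem_centralizer_centralizer_singleton.1 (resolvent_mem_centralizer_centralizer a z) b hb
  rw [commute_iff_eq, ← hleft, ← hright]
  simp only [((hres _).smul_right _).eq]

theorem exists_norm_laurentCoeff_le (hr : 0 < r) (h : sphere (0 : ℂ) r ⊆ resolventSet ℂ a) :
    ∃ C, ∀ n : ℤ, ‖laurentCoeff a r n‖ ≤ C * r ^ n := by
  have hcont : ContinuousOn (resolvent a) (sphere (0 : ℂ) r) := fun z hz =>
    (spectrum.hasDerivAt_resolvent_const_left (h hz)).continuousAt.continuousWithinAt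
  obtain ⟨C, hC⟩ := (isCompact_sphere (0 : ℂ) r).exists_bound_of_continuousOn hcont
  refine ⟨r * C, fun n => ?_⟩
  rw [mul_right_comm, mul_assoc]
  refine circleIntegral.norm_two_pi_i_inv_smul_integral_le_of_norm_le_const hr.le fun z hz => ?_
  rw [norm_smul, norm_zpow, mem_sphere_zero_iff_norm.1 hz]
  exact mul_le_mul_of_nonneg_left (hC z hz) (by positivity)

theorem laurentCoeff_eq_laurentCoeff (hr : 0 < r) (hrR : r ≤ R)
    (h : closedBall (0 : ℂ) R \ ball 0 r ⊆ resolventSet ℂ a) (n : ℤ) :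
    laurentCoeff a r n = laurentCoeff a R n := by
  have h0 : (0 : ℂ) ∉ closedBall (0 : ℂ) R \ ball 0 r := fun h => h.2 (mem_ball_self hr)
  refine congrArg _ (circleIntegral_eq_of_differentiable_on_annulus_off_countable hr hrR
    countable_empty (continuousOn_zpow_smul_resolvent h h0 n) ?_).symm
  rintro z ⟨⟨hzR, hzr⟩, -⟩
  have hz : z ∈ closedBall (0 : ℂ) R \ ball 0 r :=
    ⟨ball_subset_closedBall hzR, fun hz => hzr (ball_subset_closedBall hz)⟩
  exact (differentiableAt_zpow.2 (Or.inl (ne_of_mem_of_not_mem hz h0))).smul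
    (spectrum.hasDerivAt_resolvent_const_left (h hz)).differentiableAt

theorem pow_mul_laurentCoeff_zero (hr : 0 < r) (h : sphere (0 : ℂ) r ⊆ resolventSet ℂ a) (n : ℕ) :
    a ^ n * laurentCoeff a r 0 = laurentCoeff a r n := by
  induction n with
  | zero => simp only [pow_zero, one_mul, Nat.cast_zero]
  | succ n ih =>
    rw [pow_succ', mul_assoc, ih, mul_laurentCoeff hr h, if_neg (by lia), sub_zero, Nat.cast_succ]

theorem pow_mul_laurentCoeff_neg (hr : 0 < r) (h : sphere (0 : ℂ) r ⊆ resolventSet ℂ a) (n : ℕ) :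
    a ^ (n + 1) * laurentCoeff a r (-(n + 1 : ℕ)) = laurentCoeff a r 0 - 1 := by
  induction n with
  | zero => simpa using mul_laurentCoeff hr h (-1)
  | succ n ih =>
    rw [pow_succ, mul_assoc, mul_laurentCoeff hr h, if_neg (by lia), sub_zero, ← ih]
    congr 2

theorem isIdempotentElem_laurentCoeff_zero (hr : 0 < r) (hrR : r < R)
    (h : closedBall (0 : ℂ) R \ ball 0 r ⊆ resolventSet ℂ a) :
    IsIdempotentElem (laurentCoeff a r 0) := by
  have hR := hr.trans hrR
  have hsr : sphere (0 : ℂ) r ⊆ resolventSet ℂ a := fun z hz => h (by simp_all [hrR.le])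
  have hsR : sphere (0 : ℂ) R ⊆ resolventSet ℂ a := fun z hz => h (by simp_all [hrR.le])
  set p := laurentCoeff a r 0 with hp
  obtain ⟨C₁, hC₁⟩ := exists_norm_laurentCoeff_le hr hsr
  obtain ⟨C₂, hC₂⟩ := exists_norm_laurentCoeff_le hR hsR
  -- `a ^ (n + 1)` can be moved from the coefficient on the outer circle to the one on the inner
  -- circle, which makes `(p - 1) * p` of order `(r / R) ^ (n + 1)` for every `n`.
  have hfactor (n : ℕ) :
      (p - 1) * p = laurentCoeff a R (-(n + 1 : ℕ)) * laurentCoeff a r (n + 1 : ℕ) := by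
    have hcomm := mem_centralizer_centralizer_singleton.1
      (laurentCoeff_mem_centralizer_centralizer hR hsR (-(n + 1 : ℕ))) a (Commute.refl a)
    rw [← pow_mul_laurentCoeff_zero hr hsr, ← mul_assoc, ← (hcomm.pow_left _).eq,
      pow_mul_laurentCoeff_neg hR hsR, hp, laurentCoeff_eq_laurentCoeff hr hrR.le h]
  have hbound (n : ℕ) : ‖(p - 1) * p‖ ≤ C₂ * C₁ * (r / R) ^ (n + 1) := by
    rw [hfactor n]
    calc ‖laurentCoeff a R (-(n + 1 : ℕ)) * laurentCoeff a r (n + 1 : ℕ)‖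
        ≤ C₂ * R ^ (-(n + 1 : ℕ) : ℤ) * (C₁ * r ^ ((n + 1 : ℕ) : ℤ)) :=
          norm_mul_le_of_le (hC₂ _) (hC₁ _)
      _ = C₂ * C₁ * (r / R) ^ (n + 1) := by
          rw [zpow_neg, zpow_natCast, zpow_natCast, div_pow]
          ring
  have hlim : Tendsto (fun n : ℕ => C₂ * C₁ * (r / R) ^ (n + 1)) atTop (𝓝 0) := by
    have hgeom := tendsto_pow_atTop_nhds_zero_of_lt_one (div_nonneg hr.le hR.le)
      ((div_lt_one hR).2 hrR)
    rw [← mul_zero (C₂ * C₁)]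
    exact (hgeom.comp (tendsto_add_atTop_nat 1)).const_mul (C₂ * C₁)
  have hzero : (p - 1) * p = 0 := norm_le_zero_iff.1 (ge_of_tendsto' hlim hbound)
  rwa [sub_mul, one_mul, sub_eq_zero] at hzero

end LaurentCoeff

theorem spectrum_subset_closedBall_of_norm_pow_le {𝕜 A : Type*} [NormedField 𝕜] [NormedRing A]
    [NormedAlgebra 𝕜 A] [CompleteSpace A] {b : A} {r C : ℝ} (hr : 0 < r)
    (hb : ∀ n : ℕ, ‖b ^ (n + 1)‖ ≤ C * r ^ (n + 1)) : spectrum 𝕜 b ⊆ closedBall 0 r := by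
  intro z hz
  rw [mem_closedBall_zero_iff]
  by_contra! hlt
  have hbound (n : ℕ) : (‖z‖ / r) ^ (n + 1) ≤ C * ‖(1 : A)‖ := by
    rw [div_pow, div_le_iff₀ (by positivity), ← norm_pow, mul_right_comm]
    exact (spectrum.norm_le_norm_mul_of_mem (spectrum.pow_mem_pow b (n + 1) hz)).trans
      (mul_le_mul_of_nonneg_right (hb n) (norm_nonneg _))
  obtain ⟨n, hn⟩ := pow_unbounded_of_one_lt (C * ‖(1 : A)‖) ((one_lt_div hr).2 hlt)
  exact absurd (hbound n) (not_le.2 (hn.trans_le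
    (pow_le_pow_right₀ ((one_lt_div hr).2 hlt).le n.le_succ)))

section RieszIdempotent

variable {A : Type*} [NormedRing A] [NormedAlgebra ℂ A] [CompleteSpace A] {a : A}

theorem exists_isCommutingOuterInverse_of_annulus {r R : ℝ} (hr : 0 < r) (hrR : r < R)
    (h : closedBall (0 : ℂ) R \ ball 0 r ⊆ resolventSet ℂ a) :
    ∃ s ∈ centralizer (centralizer {a}), IsCommutingOuterInverse a s ∧
      spectrum ℂ (a * (1 - s * a)) ⊆ closedBall 0 r := by
  have hsr : sphere (0 : ℂ) r ⊆ resolventSet ℂ a := fun z hz => h (by simp_all [hrR.le])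
  set p := laurentCoeff a r 0
  set v := laurentCoeff a r (-1)
  have hpp : p * p = p := isIdempotentElem_laurentCoeff_zero hr hrR h
  have hpc := mem_centralizer_centralizer_singleton.1
    (laurentCoeff_mem_centralizer_centralizer hr hsr 0)
  have hvc := mem_centralizer_centralizer_singleton.1
    (laurentCoeff_mem_centralizer_centralizer hr hsr (-1))
  have hsc (b : A) (hb : Commute b a) : Commute b (v * (p - 1)) :=
    (hvc b hb).mul_right ((hpc b hb).sub_right (Commute.one_right b))
  have hpa : Commute a p := hpc a (Commute.refl a)
  have hav : a * v = p - 1 := by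
    simpa only [neg_add_cancel, if_true] using mul_laurentCoeff hr hsr (-1)
  have hsa : v * (p - 1) * a = 1 - p := by
    rw [← (hsc a (Commute.refl a)).eq, ← mul_assoc, hav, mul_sub, sub_mul, one_mul, hpp,
      sub_self, mul_one, zero_sub, neg_sub]
  obtain ⟨C, hC⟩ := exists_norm_laurentCoeff_le hr hsr
  refine ⟨v * (p - 1), mem_centralizer_centralizer_singleton.2 hsc,
    ⟨(hsc a (Commute.refl a)).symm, ?_⟩, ?_⟩
  · rw [sq, mul_assoc, hsa, mul_assoc, mul_sub (p - 1), mul_one, sub_mul p, one_mul, hpp, sub_self,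
      sub_zero]
  · rw [hsa, sub_sub_cancel]
    refine spectrum_subset_closedBall_of_norm_pow_le hr (C := C) fun n => ?_
    rw [hpa.mul_pow, IsIdempotentElem.pow_succ_eq n hpp, pow_mul_laurentCoeff_zero hr hsr]
    exact_mod_cast hC (n + 1 : ℕ)

theorem exists_isCommutingOuterInverse_of_countableNear (h : CountableNear (spectrum ℂ a) 0) :
    ∃ s ∈ centralizer (centralizer {a}), IsCommutingOuterInverse a s ∧
      (spectrum ℂ (a * (1 - s * a))).Countable := by
  obtain ⟨r, R, hr, hrR, hc, hannulus⟩ := h.exists_annulus (spectrum.isClosed a)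
  obtain ⟨s, hsc, hs, hsr⟩ := exists_isCommutingOuterInverse_of_annulus hr hrR
    fun z hz => not_not.1 (disjoint_left.1 hannulus hz)
  refine ⟨s, hsc, hs, (hc.insert 0).mono fun z hz => ?_⟩
  have hcomm : Commute (1 - s * a) a := (Commute.one_left a).sub_left hs.commute_mul
  exact (spectrum_mul_idempotent_subset hs.isIdempotentElem.one_sub hcomm hz).imp_right
    fun hza => ⟨closedBall_subset_closedBall hrR.le (hsr hz), hza⟩

end RieszIdempotent

section Restrict

variable {R V : Type*} [CommRing R] [AddCommGroup V] [Module R V] {f : Module.End R V}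
  {M N : Submodule R V}

theorem spectrum_prodMap {V₁ V₂ : Type*} [AddCommGroup V₁] [Module R V₁] [AddCommGroup V₂]
    [Module R V₂] (f : Module.End R V₁) (g : Module.End R V₂) :
    spectrum R (f.prodMap g : Module.End R (V₁ × V₂)) = spectrum R f ∪ spectrum R g := by
  ext r
  have hsub : algebraMap R (Module.End R (V₁ × V₂)) r - f.prodMap g =
      (algebraMap R (Module.End R V₁) r - f).prodMap (algebraMap R (Module.End R V₂) r - g) := rfl
  rw [mem_union, spectrum.mem_iff, spectrum.mem_iff, spectrum.mem_iff, hsub, Module.End.isUnit_iff,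
    Module.End.isUnit_iff, Module.End.isUnit_iff, LinearMap.coe_prodMap, Prod.map_bijective,
    not_and_or]

theorem spectrum_eq_union_restrict (hMN : IsCompl M N) (hM : ∀ x ∈ M, f x ∈ M)
    (hN : ∀ x ∈ N, f x ∈ N) :
    spectrum R f = spectrum R (f.restrict hM) ∪ spectrum R (f.restrict hN) := by
  let e := Submodule.prodEquivOfIsCompl M N hMN
  have hf : f = e.conjAlgEquiv R ((f.restrict hM).prodMap (f.restrict hN)) := by
    refine LinearMap.ext fun x => ?_
    obtain ⟨⟨m, n⟩, rfl⟩ := e.surjective x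
    simp [e, LinearEquiv.conjAlgEquiv_apply]
  rw [← spectrum_prodMap, ← AlgEquiv.spectrum_eq (e.conjAlgEquiv R), ← hf]

theorem spectrum_mapQ (hMN : IsCompl M N) (hM : ∀ x ∈ M, f x ∈ M) (hN : ∀ x ∈ N, f x ∈ N) :
    spectrum R (N.mapQ N f hN : Module.End R (V ⧸ N)) = spectrum R (f.restrict hM) := by
  let e := (Submodule.quotientEquivOfIsCompl N M hMN.symm).symm
  have hf : N.mapQ N f hN = e.conjAlgEquiv R (f.restrict hM) := by
    refine LinearMap.ext fun x => ?_
    obtain ⟨m, rfl⟩ := e.surjective x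
    simp [e, LinearEquiv.conjAlgEquiv_apply]
  rw [hf, AlgEquiv.spectrum_eq]

theorem isUnit_restrict_range_of_isCompl_ker (h : IsCompl f.range f.ker) :
    IsUnit (f.restrict (p := f.range) fun x _ => f.mem_range_self x) :=
  (Module.End.isUnit_iff _).2 (f.kerComplementEquivRange h).bijective

theorem isCompl_range_ker_of_mul_self (hker : f.ker = (f * f).ker)
    (hrange : f.range = (f * f).range) : IsCompl f.range f.ker := by
  refine ⟨Submodule.disjoint_def.2 ?_, codisjoint_iff.2 (eq_top_iff.2 fun x _ => ?_)⟩
  · rintro _ ⟨x, rfl⟩ hx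
    exact (hker ▸ hx : x ∈ f.ker)
  · obtain ⟨y, hy⟩ : f x ∈ (f * f).range := hrange ▸ f.mem_range_self x
    exact Submodule.mem_sup.2 ⟨f y, f.mem_range_self y, x - f y,
      by rw [LinearMap.mem_ker, map_sub, ← hy, Module.End.mul_apply, sub_self], add_sub_cancel _ _⟩

theorem ker_pow_eq_of_ker_pow_add_one_eq {p : ℕ} (h : (f ^ p).ker = (f ^ (p + 1)).ker) {n : ℕ}
    (hn : p ≤ n) : (f ^ n).ker = (f ^ p).ker := by
  induction n, hn using Nat.le_induction with
  | base => rfl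
  | succ n _ ih =>
    rw [pow_succ, Module.End.mul_eq_comp, LinearMap.ker_comp, ih, ← LinearMap.ker_comp,
      ← Module.End.mul_eq_comp, ← pow_succ, h]

theorem range_pow_eq_of_range_pow_add_one_eq {q : ℕ} (h : (f ^ q).range = (f ^ (q + 1)).range)
    {n : ℕ} (hn : q ≤ n) : (f ^ n).range = (f ^ q).range := by
  induction n, hn using Nat.le_induction with
  | base => rfl
  | succ n _ ih =>
    rw [pow_succ', Module.End.mul_eq_comp, LinearMap.range_comp, ih, ← LinearMap.range_comp,
      ← Module.End.mul_eq_comp, ← pow_succ', h]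

theorem isCompl_range_pow_ker_pow {p q n : ℕ} (hp : (f ^ p).ker = (f ^ (p + 1)).ker)
    (hq : (f ^ q).range = (f ^ (q + 1)).range) (hpn : p ≤ n) (hqn : q ≤ n) :
    IsCompl (f ^ n).range (f ^ n).ker := by
  refine isCompl_range_ker_of_mul_self ?_ ?_ <;> rw [← pow_add]
  · rw [ker_pow_eq_of_ker_pow_add_one_eq hp hpn,
      ker_pow_eq_of_ker_pow_add_one_eq hp (Nat.le_add_right_of_le hpn)]
  · rw [range_pow_eq_of_range_pow_add_one_eq hq hqn,
      range_pow_eq_of_range_pow_add_one_eq hq (Nat.le_add_right_of_le hqn)]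

theorem apply_mem_range_of_commute {g : Module.End R V} (h : Commute f g) :
    ∀ x ∈ g.range, f x ∈ g.range := by
  rintro _ ⟨x, rfl⟩
  exact ⟨f x, (LinearMap.congr_fun h x).symm⟩

theorem apply_mem_ker_of_commute {g : Module.End R V} (h : Commute f g) :
    ∀ x ∈ g.ker, f x ∈ g.ker := fun x hx =>
  LinearMap.mem_ker.2 <| by rw [← Module.End.mul_apply, ← h.eq, Module.End.mul_apply,
    LinearMap.mem_ker.1 hx, map_zero]

theorem isUnit_restrict_range_pow {n : ℕ} (hn : n ≠ 0) (h : IsCompl (f ^ n).range (f ^ n).ker)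
    (hf : ∀ x ∈ (f ^ n).range, f x ∈ (f ^ n).range) : IsUnit (f.restrict hf) := by
  rw [← isUnit_pow_iff hn, Module.End.pow_restrict]
  exact isUnit_restrict_range_of_isCompl_ker h

theorem isNilpotent_restrict_ker_pow {n : ℕ} (hf : ∀ x ∈ (f ^ n).ker, f x ∈ (f ^ n).ker) :
    IsNilpotent (f.restrict hf) := by
  refine ⟨n, LinearMap.ext fun x => Subtype.ext ?_⟩
  rw [Module.End.pow_restrict]
  exact x.2

end Restrict

theorem spectrum_subset_zero_of_isNilpotent {𝕜 A : Type*} [Field 𝕜] [Ring A] [Algebra 𝕜 A] {a : A}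
    (ha : IsNilpotent a) : spectrum 𝕜 a ⊆ {0} := by
  intro z hz
  by_contra hz0
  have hunit : IsUnit (algebraMap 𝕜 A z) := (isUnit_iff_ne_zero.2 hz0).map (algebraMap 𝕜 A)
  refine hz ?_
  rw [spectrum.mem_resolventSet_iff, sub_eq_add_neg]
  exact ha.neg.isUnit_add_left_of_commute hunit (Algebra.commute_algebraMap_right z _)

section BanachSpace

variable {𝕜 X : Type*} [NontriviallyNormedField 𝕜] [NormedAddCommGroup X] [NormedSpace 𝕜 X]
  [CompleteSpace X] {T : X →L[𝕜] X} {M N : Submodule 𝕜 X}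

/- The quotient map of `T` on `X ⧸ N` is bounded and similar to `T_M`, even if `M` is not closed;
hence its spectrum is closed and does not contain `0`. -/
theorem eventually_mem_spectrum_restrict (hN_closed : IsClosed (N : Set X)) (hMN : IsCompl M N)
    (hM : ∀ x ∈ M, T x ∈ M) (hN : ∀ x ∈ N, T x ∈ N)
    (hunit : IsUnit ((T : Module.End 𝕜 X).restrict hM)) :
    ∀ᶠ z in 𝓝 (0 : 𝕜), z ∈ spectrum 𝕜 T → z ∈ spectrum 𝕜 (T.restrict hN) := by
  have := hN_closed
  have := hN_closed.completeSpace_coe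
  let Q : (X ⧸ N) →L[𝕜] (X ⧸ N) := N.liftQL (N.mkQL ∘L T) fun x hx =>
    (Submodule.Quotient.mk_eq_zero N).2 (hN x hx)
  have hQ : spectrum 𝕜 Q = spectrum 𝕜 ((T : Module.End 𝕜 X).restrict hM) :=
    ContinuousLinearMap.spectrum_eq.trans (spectrum_mapQ hMN hM hN)
  have hQ0 : IsUnit Q := (spectrum.zero_notMem_iff 𝕜).1 (hQ ▸ (spectrum.zero_notMem_iff 𝕜).2 hunit)
  filter_upwards [eventually_notMem_spectrum_of_isUnit hQ0] with z hzQ hz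
  rw [ContinuousLinearMap.spectrum_eq, spectrum_eq_union_restrict hMN hM hN, ← hQ] at hz
  rw [ContinuousLinearMap.spectrum_eq]
  exact hz.resolve_left hzQ

end BanachSpace

section SigmaStar

variable {X : Type*} [NormedAddCommGroup X] [NormedSpace ℂ X]

theorem isBrowder_of_isUnit {T : X →L[ℂ] X} (h : IsUnit T) : IsBrowder T := by
  obtain ⟨u, rfl⟩ := h
  let e := ContinuousLinearEquiv.unitsEquiv ℂ X u
  refine ⟨.of_isQuasiInverse (v := (e.symm : X →L[ℂ] X)) e.toLinearEquiv.isQuasiInverse,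
    ⟨0, ?_⟩, ⟨0, ?_⟩⟩ <;> rw [zero_add, pow_zero, pow_one]
  · exact LinearMap.ker_id.trans e.toLinearEquiv.ker.symm
  · exact LinearMap.range_id.trans e.toLinearEquiv.range.symm

theorem isUnit_sub_smul_one_iff {T : X →L[ℂ] X} {z : ℂ} :
    IsUnit (T - z • (1 : X →L[ℂ] X)) ↔ z ∉ spectrum ℂ T := by
  rw [spectrum.notMem_iff, Algebra.algebraMap_eq_smul_one, ← neg_sub, IsUnit.neg_iff]

theorem sigmaStar_subset_spectrum (k : SpectrumKind) (T : X →L[ℂ] X) :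
    sigmaStar k T ⊆ spectrum ℂ T := by
  refine fun z hz => by_contra fun hzT => ?_
  have hb : IsBrowder (T - z • (1 : X →L[ℂ] X)) :=
    isBrowder_of_isUnit (isUnit_sub_smul_one_iff.2 hzT)
  match k with
  | .usual => exact hzT hz
  | .browder => exact hz hb
  | .drazin => exact hz hb.2

theorem drazinSpectrum_subset_sigmaStar (k : SpectrumKind) (T : X →L[ℂ] X) :
    drazinSpectrum T ⊆ sigmaStar k T := by
  match k with
  | .usual => exact sigmaStar_subset_spectrum .drazin T
  | .browder => exact fun z hz hb => hz hb.2
  | .drazin => exact Subset.rfl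

variable [CompleteSpace X] {T : X →L[ℂ] X}

theorem eventually_notMem_spectrum_of_isCompl_range_pow_ker_pow {n : ℕ} (hn : n ≠ 0)
    (h : IsCompl ((T : Module.End ℂ X) ^ n).range ((T : Module.End ℂ X) ^ n).ker) :
    ∀ᶠ z in 𝓝 (0 : ℂ), z ≠ 0 → z ∉ spectrum ℂ T := by
  have hcomm : Commute (T : Module.End ℂ X) ((T : Module.End ℂ X) ^ n) := Commute.self_pow _ n
  have hker := apply_mem_ker_of_commute hcomm
  have hrange := apply_mem_range_of_commute hcomm
  have hclosed : IsClosed (((T : Module.End ℂ X) ^ n).ker : Set X) :=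
    ContinuousLinearMap.toLinearMap_pow T n ▸ (T ^ n).isClosed_ker
  filter_upwards [eventually_mem_spectrum_restrict hclosed h hrange hker
    (isUnit_restrict_range_pow hn h hrange)] with z hz hz0 hzT
  have := hclosed.completeSpace_coe
  have hzker := hz hzT
  rw [ContinuousLinearMap.spectrum_eq] at hzker
  exact hz0 (spectrum_subset_zero_of_isNilpotent (isNilpotent_restrict_ker_pow hker) hzker)

theorem IsDrazinInvertible.eventually_notMem_spectrum (h : IsDrazinInvertible T) :
    ∀ᶠ z in 𝓝 (0 : ℂ), z ≠ 0 → z ∉ spectrum ℂ T := by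
  obtain ⟨⟨p, hp⟩, ⟨q, hq⟩⟩ := h
  rw [ContinuousLinearMap.toLinearMap_pow, ContinuousLinearMap.toLinearMap_pow] at hp hq
  exact eventually_notMem_spectrum_of_isCompl_range_pow_ker_pow (n := p + q + 1) (by lia)
    (isCompl_range_pow_ker_pow hp hq (by lia) (by lia))

theorem derivedSet_spectrum_subset_drazinSpectrum (T : X →L[ℂ] X) :
    derivedSet (spectrum ℂ T) ⊆ drazinSpectrum T := by
  intro z hz hd
  rw [mem_derivedSet, accPt_iff_frequently] at hz
  have htendsto : Tendsto (fun w => w - z) (𝓝 z) (𝓝 0) :=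
    (continuous_sub_right z).tendsto' z 0 (sub_self z)
  obtain ⟨w, ⟨hwz, hwT⟩, hw⟩ :=
    (hz.and_eventually (htendsto.eventually hd.eventually_notMem_spectrum)).exists
  refine hw (sub_ne_zero.2 hwz) ?_
  rwa [← Algebra.algebraMap_eq_smul_one, spectrum.mem_iff, map_sub, sub_sub_sub_cancel_right]

theorem isClosed_sigmaStar (k : SpectrumKind) (T : X →L[ℂ] X) : IsClosed (sigmaStar k T) :=
  isClosed_of_derivedSet_subset ((derivedSet_spectrum_subset_drazinSpectrum T).trans
    (drazinSpectrum_subset_sigmaStar k T)) (sigmaStar_subset_spectrum k T)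

theorem countable_spectrum_sdiff_sigmaStar (k : SpectrumKind) (T : X →L[ℂ] X) :
    (spectrum ℂ T \ sigmaStar k T).Countable :=
  countable_sdiff_of_derivedSet_subset (spectrum.isClosed T)
    ((derivedSet_spectrum_subset_drazinSpectrum T).trans (drazinSpectrum_subset_sigmaStar k T))

theorem countable_sigmaStar_iff {k : SpectrumKind} :
    (sigmaStar k T).Countable ↔ (spectrum ℂ T).Countable :=
  ⟨fun h => (h.union (countable_spectrum_sdiff_sigmaStar k T)).mono
    (union_sdiff_cancel (sigmaStar_subset_spectrum k T)).ge,
    fun h => h.mono (sigmaStar_subset_spectrum k T)⟩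

theorem countableNear_sigmaStar_iff {k : SpectrumKind} {z : ℂ} :
    CountableNear (sigmaStar k T) z ↔ CountableNear (spectrum ℂ T) z :=
  ⟨fun h => (h.union_countable (countable_spectrum_sdiff_sigmaStar k T)).mono
    (union_sdiff_cancel (sigmaStar_subset_spectrum k T)).ge,
    fun h => h.mono (sigmaStar_subset_spectrum k T)⟩

end SigmaStar

section Reduction

variable {X : Type*} [NormedAddCommGroup X] [NormedSpace ℂ X]

theorem mem_comm_iff {S T : X →L[ℂ] X} : S ∈ comm T ↔ Commute S T := by
  simp only [comm, mem_centralizer_iff, mem_singleton_iff, forall_eq, commute_iff_eq,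
    eq_comm (a := T * S)]

theorem mem_comm2_iff {S T : X →L[ℂ] X} : S ∈ comm2 T ↔ ∀ R, Commute R T → Commute R S :=
  mem_centralizer_centralizer_singleton

theorem one_sub_mul_mem_comm2 {S T : X →L[ℂ] X} (hS : S ∈ comm2 T) : 1 - S * T ∈ comm2 T :=
  mem_comm2_iff.2 fun R hR => commute_one_sub_mul (mem_comm2_iff.1 hS R hR) hR

theorem comm2_subset_comm (T : X →L[ℂ] X) : comm2 T ⊆ comm T :=
  centralizer_subset (singleton_subset_iff.2 (mem_comm_iff.2 (Commute.refl T)))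

theorem isRed_ker_range {P S : X →L[ℂ] X} (hP : IsIdempotentElem P) (hS : Commute S P) :
    IsRed S P.ker P.range where
  inv_left := apply_mem_ker_of_commute (hS.map ContinuousLinearMap.toLinearMapRingHom)
  inv_right := apply_mem_range_of_commute (hS.map ContinuousLinearMap.toLinearMapRingHom)
  closed_left := P.isClosed_ker
  closed_right := ContinuousLinearMap.IsIdempotentElem.isClosed_range hP
  isCompl := (LinearMap.IsIdempotentElem.isCompl
    (hP.map ContinuousLinearMap.toLinearMapRingHom)).symm

variable [CompleteSpace X] {T : X →L[ℂ] X} {M N : Submodule ℂ X}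

theorem countableNear_spectrum_of_isCompl (hN_closed : IsClosed (N : Set X)) (hMN : IsCompl M N)
    (hM : ∀ x ∈ M, T x ∈ M) (hN : ∀ x ∈ N, T x ∈ N)
    (hbij : Function.Bijective (T.restrict hM)) (hc : (spectrum ℂ (T.restrict hN)).Countable) :
    CountableNear (spectrum ℂ T) 0 :=
  (CountableNear.of_countable hc 0).mono_eventually (eventually_mem_spectrum_restrict hN_closed hMN
    hM hN ((Module.End.isUnit_iff _).2 hbij))

theorem IsAlmostInvPair.countableNear_spectrum (h : IsAlmostInvPair T M N) :
    CountableNear (spectrum ℂ T) 0 := by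
  obtain ⟨h, hunit, hc⟩ := h
  have := h.closed_left.completeSpace_coe
  exact countableNear_spectrum_of_isCompl h.closed_right h.isCompl _ _
    (ContinuousLinearMap.isUnit_iff_bijective.1 hunit) hc

theorem IsCommutingOuterInverse.isAlmostInvPair {S : X →L[ℂ] X} (hS : IsCommutingOuterInverse T S)
    (hc : (spectrum ℂ (T * (1 - S * T))).Countable) :
    IsAlmostInvPair T (1 - S * T).ker (1 - S * T).range := by
  have hP : IsIdempotentElem (1 - S * T) := hS.isIdempotentElem.one_sub
  have hTP : Commute T (1 - S * T) := (Commute.one_right T).sub_right hS.commute_mul.symm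
  have hred := isRed_ker_range hP hTP
  have hredS := isRed_ker_range hP (S := S)
    (commute_one_sub_mul (Commute.refl S) hS.commute)
  have hredTP := isRed_ker_range hP (hTP.mul_left (Commute.refl _))
  have hST (x) (hx : x ∈ (1 - S * T).ker) : S (T x) = x := (sub_eq_zero.1 hx).symm
  have hTS (x) (hx : x ∈ (1 - S * T).ker) : T (S x) = x :=
    (DFunLike.congr_fun hS.commute.eq x).symm.trans (hST x hx)
  have hrestrict : (T * (1 - S * T)).restrict hredTP.inv_right = T.restrict hred.inv_right := by
    ext ⟨_, x, rfl⟩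
    exact congrArg T (DFunLike.congr_fun hP x)
  refine ⟨hred, ⟨⟨T.restrict hred.inv_left, S.restrict hredS.inv_left, ?_, ?_⟩, rfl⟩, ?_⟩
  · ext x
    exact hTS x x.2
  · ext x
    exact hST x x.2
  · have := hred.closed_right.completeSpace_coe
    rw [← hrestrict, ContinuousLinearMap.spectrum_eq]
    rw [ContinuousLinearMap.spectrum_eq,
      spectrum_eq_union_restrict hredTP.isCompl hredTP.inv_left hredTP.inv_right] at hc
    exact hc.mono subset_union_right

theorem exists_isRed2_isAlmostInvPair (h : CountableNear (spectrum ℂ T) 0) :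
    ∃ M N : Submodule ℂ X, IsRed2 T M N ∧ IsAlmostInvPair T M N := by
  obtain ⟨S, hS, hST, hc⟩ := exists_isCommutingOuterInverse_of_countableNear h
  exact ⟨_, _, fun R hR => isRed_ker_range hST.isIdempotentElem.one_sub
    (mem_comm2_iff.1 (one_sub_mul_mem_comm2 hS) R (mem_comm_iff.1 hR)), hST.isAlmostInvPair hc⟩

theorem isAlmostInvertible_iff : IsAlmostInvertible T ↔ CountableNear (spectrum ℂ T) 0 := by
  refine ⟨fun ⟨M, N, h⟩ => h.countableNear_spectrum, fun h => ?_⟩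
  obtain ⟨M, N, -, h⟩ := exists_isRed2_isAlmostInvPair h
  exact ⟨M, N, h⟩

theorem exists_isCompl_iff (k : SpectrumKind) :
    (∃ (M N : Submodule ℂ X) (hM : ∀ x ∈ M, T x ∈ M) (hN : ∀ x ∈ N, T x ∈ N),
        IsClosed (N : Set X) ∧ IsCompl M N ∧ Function.Bijective (T.restrict hM) ∧
          (sigmaStar k (T.restrict hN)).Countable) ↔ CountableNear (spectrum ℂ T) 0 := by
  constructor
  · rintro ⟨M, N, hM, hN, hN_closed, hMN, hbij, hc⟩
    have := hN_closed.completeSpace_coe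
    exact countableNear_spectrum_of_isCompl hN_closed hMN hM hN hbij (countable_sigmaStar_iff.1 hc)
  · intro h
    obtain ⟨M, N, h, hunit, hc⟩ := isAlmostInvertible_iff.2 h
    have := h.closed_left.completeSpace_coe
    exact ⟨M, N, h.inv_left, h.inv_right, h.closed_right, h.isCompl,
      ContinuousLinearMap.isUnit_iff_bijective.1 hunit, hc.mono (sigmaStar_subset_spectrum k _)⟩

end Reduction

section Ordinals

variable {X : Type*} [NormedAddCommGroup X] [NormedSpace ℂ X] {T : X →L[ℂ] X}

theorem isGInvertible_iff_of_isSuccLimit {k : SpectrumKind} {α : Ordinal.{0}}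
    (hα : Order.IsSuccLimit α) :
    IsGInvertible k α T ↔ ∃ β : Ordinal.{0}, β + 1 < α ∧ IsGInvertibleSucc k β T := by
  refine ⟨?_, fun h => .inr (.inr ⟨hα, h⟩)⟩
  rintro (⟨rfl, -⟩ | ⟨β, rfl, -⟩ | ⟨-, h⟩)
  · exact absurd isMin_bot hα.1
  · exact absurd (hα.add_one_lt (lt_add_one β)) (lt_irrefl _)
  · exact h

variable [CompleteSpace X]

theorem isGInvertible_omega_one_iff (k : SpectrumKind) (T : X →L[ℂ] X) :
    IsGInvertible k ω₁ T ↔ IsAlmostInvertible T := by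
  have key {M N : Submodule ℂ X} (h : IsRed T M N) :
      (∃ β : Ordinal.{0}, β + 1 < ω₁ ∧ acc β (sigmaStar k (T.restrict h.inv_right)) ⊆ {0}) ↔
        (spectrum ℂ (T.restrict h.inv_right)).Countable := by
    have := h.closed_right.completeSpace_coe
    rw [← countable_sigmaStar_iff (k := k)]
    exact exists_iteratedDerivedSet_subset_singleton_iff (isClosed_sigmaStar k _) 0
  rw [isGInvertible_iff_of_isSuccLimit isSuccLimit_omega_one]
  constructor
  · rintro ⟨β, hβ, M, N, h, hunit, hacc⟩
    exact ⟨M, N, h, hunit, (key h).1 ⟨β, hβ, hacc⟩⟩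
  · rintro ⟨M, N, h, hunit, hc⟩
    obtain ⟨β, hβ, hacc⟩ := (key h).2 hc
    exact ⟨β, hβ, M, N, h, hunit, hacc⟩

theorem notMem_acc_omega_one_sigmaStar_iff (k : SpectrumKind) (T : X →L[ℂ] X) (z : ℂ) :
    z ∉ acc ω₁ (sigmaStar k T) ↔ CountableNear (spectrum ℂ T) z :=
  (notMem_iteratedDerivedSet_omega_one_iff (isClosed_sigmaStar k T)).trans
    countableNear_sigmaStar_iff

end Ordinals

section SpectralSets

variable {X : Type*} [NormedAddCommGroup X] [NormedSpace ℂ X] {T : X →L[ℂ] X} {s : Set ℂ}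

theorem IsSpectralSet.eventually_mem (hs : IsSpectralSet T s) {z : ℂ} (hz : z ∈ s) :
    ∀ᶠ w in 𝓝 z, w ∈ spectrum ℂ T → w ∈ s := by
  have h : ∀ᶠ w : spectrum ℂ T in 𝓝 ⟨z, hs.1 hz⟩, (w : ℂ) ∈ s := hs.2.isOpen.mem_nhds hz
  rw [nhds_subtype, eventually_comap] at h
  exact h.mono fun w hw hwT => hw ⟨w, hwT⟩ rfl

theorem IsSpectralSet.countableNear_spectrum (hs : IsSpectralSet T s) (hc : s.Countable) {z : ℂ}
    (hz : z ∈ s) : CountableNear (spectrum ℂ T) z :=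
  (CountableNear.of_countable hc z).mono_eventually (hs.eventually_mem hz)

variable [CompleteSpace X]

theorem IsSpectralSet.countable_iff (hs : IsSpectralSet T s) (z : ℂ) :
    s.Countable ↔ s \ {z} ⊆ ⋃ β : Ordinal.{0}, ⋃ _ : β < ω₁, iso (acc β (spectrum ℂ T)) := by
  have hunion : (⋃ β : Ordinal.{0}, ⋃ _ : β < ω₁, iso (acc β (spectrum ℂ T))) =
      spectrum ℂ T \ acc ω₁ (spectrum ℂ T) := (sdiff_iteratedDerivedSet_eq_iUnion _ _).symm
  have hclosed := spectrum.isClosed (𝕜 := ℂ) T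
  rw [hunion]
  constructor
  · exact fun hc w hw => ⟨hs.1 hw.1, (notMem_iteratedDerivedSet_omega_one_iff hclosed).2
      (hs.countableNear_spectrum hc hw.1)⟩
  · intro h
    exact ((countable_sdiff_iteratedDerivedSet hclosed ω₁).mono h).of_sdiff (countable_singleton z)

theorem exists_countable_isSpectralSet_iff {z : ℂ} :
    (∃ s : Set ℂ, IsSpectralSet T s ∧ s.Countable ∧ z ∉ spectrum ℂ T \ s) ↔
      CountableNear (spectrum ℂ T) z := by
  constructor
  · rintro ⟨s, hs, hc, hz⟩
    by_cases hzs : z ∈ s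
    · exact hs.countableNear_spectrum hc hzs
    · exact (CountableNear.of_countable countable_empty z).mono_eventually
        ((spectrum.isClosed T).isOpen_compl.mem_nhds fun hzT => hz ⟨hzT, hzs⟩)
  · intro h
    obtain ⟨r, R, hr, hrR, hc, hdisj⟩ := h.exists_annulus (spectrum.isClosed T)
    have hball : (↑) ⁻¹' ball z r = ((↑) ⁻¹' closedBall z R : Set (spectrum ℂ T)) := by
      ext w
      refine ⟨fun hw => ball_subset_closedBall (ball_subset_ball hrR.le hw), fun hw => ?_⟩
      exact by_contra fun hwr => hdisj.notMem_of_mem_left ⟨hw, hwr⟩ w.2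
    refine ⟨closedBall z R ∩ spectrum ℂ T, ⟨inter_subset_right, ?_⟩, hc,
      fun hz => hz.2 ⟨mem_closedBall_self (hr.trans hrR).le, hz.1⟩⟩
    rw [Subtype.preimage_coe_inter_self]
    exact ⟨isClosed_closedBall.preimage continuous_subtype_val,
      hball ▸ isOpen_ball.preimage continuous_subtype_val⟩

end SpectralSets

section Idempotents

variable {X : Type*} [NormedAddCommGroup X] [NormedSpace ℂ X] {S T : X →L[ℂ] X}

theorem sub_sq_mul_eq (hS : S ∈ comm T) : T - T ^ 2 * S = T * (1 - S * T) := by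
  rw [mul_sub, mul_one, (mem_comm_iff.1 hS).eq, sq, mul_assoc]

variable [CompleteSpace X]

theorem exists_isIdempotentElem_mem_comm2 (k : SpectrumKind)
    (h : CountableNear (spectrum ℂ T) 0) :
    ∃ P ∈ comm2 T, IsIdempotentElem P ∧ IsAlmostInvertible (T + P) ∧
      (sigmaStar k (T * P)).Countable := by
  obtain ⟨S, hS, hST, hc⟩ := exists_isCommutingOuterInverse_of_countableNear h
  exact ⟨1 - S * T, one_sub_mul_mem_comm2 hS, hST.isIdempotentElem.one_sub,
    isAlmostInvertible_iff.2 (hST.countableNear_spectrum_add_one_sub hc),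
    hc.mono (sigmaStar_subset_spectrum k _)⟩

theorem exists_sq_mul_eq_mem_comm2 (k : SpectrumKind) (h : CountableNear (spectrum ℂ T) 0) :
    ∃ S ∈ comm2 T, S ^ 2 * T = S ∧ (sigmaStar k (T - T ^ 2 * S)).Countable := by
  obtain ⟨S, hS, hST, hc⟩ := exists_isCommutingOuterInverse_of_countableNear h
  refine ⟨S, hS, hST.sq_mul, ?_⟩
  rw [sub_sq_mul_eq (comm2_subset_comm T hS)]
  exact hc.mono (sigmaStar_subset_spectrum k _)

theorem isAlmostInvertible_of_isIdempotentElem {k : SpectrumKind} {P : X →L[ℂ] X}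
    (hPT : P ∈ comm T) (hP : IsIdempotentElem P) (h : IsAlmostInvertible (T + P))
    (hc : (sigmaStar k (T * P)).Countable) : IsAlmostInvertible T :=
  isAlmostInvertible_iff.2 (countableNear_spectrum_of_add_idempotent hP (mem_comm_iff.1 hPT)
    (isAlmostInvertible_iff.1 h) (countable_sigmaStar_iff.1 hc))

theorem isAlmostInvertible_of_sq_mul_eq {k : SpectrumKind} (hS : S ∈ comm T) (hS_sq : S ^ 2 * T = S)
    (hc : (sigmaStar k (T - T ^ 2 * S)).Countable) : IsAlmostInvertible T := by
  rw [sub_sq_mul_eq hS, countable_sigmaStar_iff] at hc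
  exact isAlmostInvertible_iff.2 (IsCommutingOuterInverse.countableNear_spectrum
    ⟨mem_comm_iff.1 hS, hS_sq⟩ hc)

end Idempotents

end AlmostInv

theorem mainTheorem3 {X : Type*} [NormedAddCommGroup X] [NormedSpace ℂ X] [CompleteSpace X]
    (k : AlmostInv.SpectrumKind) (T : X →L[ℂ] X) :
    List.TFAE [
      AlmostInv.IsAlmostInvertible T,
      AlmostInv.IsGInvertible k ω₁ T,
      (0 : ℂ) ∉ AlmostInv.acc ω₁ (AlmostInv.sigmaStar k T),
      ∃ M N : Submodule ℂ X, AlmostInv.IsRed2 T M N ∧ AlmostInv.IsAlmostInvPair T M N,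
      ∃ (M N : Submodule ℂ X) (hM : ∀ x ∈ M, T x ∈ M) (hN : ∀ x ∈ N, T x ∈ N),
        IsClosed (N : Set X) ∧ IsCompl M N ∧ Function.Bijective (T.restrict hM) ∧
          (AlmostInv.sigmaStar k (T.restrict hN)).Countable,
      ∃ s : Set ℂ, AlmostInv.IsSpectralSet T s ∧ s.Countable ∧ (0 : ℂ) ∉ spectrum ℂ T \ s,
      ∃ s : Set ℂ, AlmostInv.IsSpectralSet T s ∧ (0 : ℂ) ∉ spectrum ℂ T \ s ∧
        s \ {0} ⊆ ⋃ β : Ordinal.{0}, ⋃ _ : β < ω₁,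
          AlmostInv.iso (AlmostInv.acc β (spectrum ℂ T)),
      ∃ P ∈ AlmostInv.comm T, IsIdempotentElem P ∧ AlmostInv.IsAlmostInvertible (T + P) ∧
        (AlmostInv.sigmaStar k (T * P)).Countable,
      ∃ P ∈ AlmostInv.comm2 T, IsIdempotentElem P ∧ AlmostInv.IsAlmostInvertible (T + P) ∧
        (AlmostInv.sigmaStar k (T * P)).Countable,
      ∃ S ∈ AlmostInv.comm T, S ^ 2 * T = S ∧
        (AlmostInv.sigmaStar k (T - T ^ 2 * S)).Countable,
      ∃ S ∈ AlmostInv.comm2 T, S ^ 2 * T = S ∧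
        (AlmostInv.sigmaStar k (T - T ^ 2 * S)).Countable] := by
  open AlmostInv in
  tfae_have 1 ↔ 2 := (isGInvertible_omega_one_iff k T).symm
  tfae_have 1 ↔ 3 := isAlmostInvertible_iff.trans (notMem_acc_omega_one_sigmaStar_iff k T 0).symm
  tfae_have 1 → 4 := fun h => exists_isRed2_isAlmostInvPair (isAlmostInvertible_iff.1 h)
  tfae_have 4 → 1 := fun ⟨M, N, _, h⟩ => ⟨M, N, h⟩
  tfae_have 1 ↔ 5 := isAlmostInvertible_iff.trans (exists_isCompl_iff k).symm
  tfae_have 1 ↔ 6 := isAlmostInvertible_iff.trans exists_countable_isSpectralSet_iff.symm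
  tfae_have 6 → 7 := fun ⟨s, hs, hc, h0⟩ => ⟨s, hs, h0, (hs.countable_iff 0).1 hc⟩
  tfae_have 7 → 6 := fun ⟨s, hs, h0, h⟩ => ⟨s, hs, (hs.countable_iff 0).2 h, h0⟩
  tfae_have 1 → 9 := fun h => exists_isIdempotentElem_mem_comm2 k (isAlmostInvertible_iff.1 h)
  tfae_have 9 → 8 := fun ⟨P, hP, h⟩ => ⟨P, comm2_subset_comm T hP, h⟩
  tfae_have 8 → 1 := fun ⟨_, hP, hPP, h, hc⟩ => isAlmostInvertible_of_isIdempotentElem hP hPP h hc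
  tfae_have 1 → 11 := fun h => exists_sq_mul_eq_mem_comm2 k (isAlmostInvertible_iff.1 h)
  tfae_have 11 → 10 := fun ⟨S, hS, h⟩ => ⟨S, comm2_subset_comm T hS, h⟩
  tfae_have 10 → 1 := fun ⟨_, hS, hSS, hc⟩ => isAlmostInvertible_of_sq_mul_eq hS hSS hc
  tfae_finish
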